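/- **Lemma 3.1** (label `bound`). *Setting.* Let $(\Omega,\Im,P)$ be a probability space and $\mathcal H\subset\mathcal F\subset\Im$ sigma-algebras containing the $P$-null sets. Let $Y$ be an $\mathcal F$-measurable random variable in $\mathbb R^d$, and let $\Xi$ be the set of $\mathcal H$-measurable $\mathbb R^d$-valued random variables; $\xi Y$ is the scalar product and $|\cdot|$ the Euclidean norm. Write $V^+=\max(V,0)$, $V^-=\max(-V,0)$. For a real random variable $Z$, $E(Z|\mathcal H):=E(Z^+|\mathcal H)-E(Z^-|\mathcal H)$, where conditional expectations of non-negative variables are $[0,\infty]$-valued. Assume: 1. $D\in\mathcal B(\mathbb R^d)\otimes\mathcal H$ is a random set such that for almost all $\omega$, $D(\omega)$ is a (non-empty) vector subspace of $\mathbb R^d$ and is the smallest affine subspace containing the support of the regular conditional distribution $P(Y\in\cdot\,|\mathcal H)(\omega)$. 2. $\alpha,\beta>0$ are $\mathcal H$-measurable random variables such that for all $\xi\in\Xi$ with $\xi\in D$ a.s., $P(\xi Y\le-\alpha|\xi|\,|\mathcal H)\ge\beta$ a.s. 3. $V:\Omega\times\mathbb R\to\mathbb R$; for almost all $\omega$,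 $V(\omega,\cdot)$ is nondecreasing and continuous; $V(\cdot,x)$ is $\mathcal F$-measurable for each $x$. 4. For all $x,y\in\mathbb R$, $E(V^-(x-|y||Y|)\,|\mathcal H)<\infty$ and $E(V^+(x+|y||Y|)\,|\mathcal H)<\infty$ a.s. 5. There are constants $C>0$ and $\underline\gamma>\overline\gamma>0$ such that, almost surely, for all $x\in\mathbb R$ and $\lambda\ge1$, $V(\lambda x)\le\lambda^{\overline\gamma}V(x)+C\lambda^{\overline\gamma}$ and $V(\lambda x)\le\lambda^{\underline\gamma}V(x)+C\lambda^{\underline\gamma}$. 6. There is a non-negative $\mathcal H$-measurable random variable $N$ with $P\left(V(-N)<-\frac{2C}{\beta}-1\,\middle|\,\mathcal H\right)\ge1-\beta/2$ a.s. For an $\mathcal H$-measurable real random variable $X$ (in particular for a constant $X=x\in\mathbb R$) put $$v(X):=\operatorname{ess.sup}_{\xi\in\Xi}E(V(X+\xi Y)\,|\mathcal H).$$ *Conclusions.* (a) For all real $x_0<x_1$ there is an $\mathcal H$-measurable random variable $K=K(\omega,x_0,x_1)>0$ such that for every $x\in[x_0,x_1]$, almost surely, $$v(x)=\operatorname{ess.sup}_{\xi\in\Xi,\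 |\xi|\le K}E(V(x+\xi Y)\,|\mathcal H).$$ (b) For every $x\in\mathbb R$, $-\infty<v(x)<+\infty$ a.s. (c) For every $\mathcal H$-measurable random variable $I>0$ there is an $\mathcal H$-measurable random variable $N'>0$ such that $v(-N')\le-I$ a.s. Moreover, for the same $N'$ and every function $w:\Omega\times\mathbb R\to[-\infty,\infty]$ such that $w(\cdot,x)=v(x)$ a.s. for each $x\in\mathbb R$ and $w(\omega,\cdot)$ is nondecreasing for almost all $\omega$, one has $w(\omega,-N'(\omega))\le-I(\omega)$ for almost all $\omega$. -/

import Mathlib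

open MeasureTheory ProbabilityTheory
open scoped ENNReal

noncomputable section

namespace OneStep

/-- The generalized conditional expectation `E(Z|ℋ) = E(Z⁺|ℋ) - E(Z⁻|ℋ)`, with values in
`[-∞, ∞]`. The conditional expectations of the non-negative variables `Z⁺`, `Z⁻` are always
defined, with values in `[0, ∞]`. (Where both are infinite the difference is meaningless.) -/
def genCondExp {Ω : Type*} (ℋ : MeasurableSpace Ω) {m0 : MeasurableSpace Ω} (P : Measure Ω)
    (Z : Ω → ℝ) : Ω → EReal :=
  fun ω => ((condLExp ℋ P (fun ω' => ENNReal.ofReal (Z ω')) ω : ℝ≥0∞) : EReal)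
    - ((condLExp ℋ P (fun ω' => ENNReal.ofReal (-Z ω')) ω : ℝ≥0∞) : EReal)

/-- `f` is (a version of) the essential supremum of the family `S` of random variables: the
almost surely smallest random variable that dominates every member of `S` almost surely. -/
def IsEssSup {Ω : Type*} {m0 : MeasurableSpace Ω} (P : Measure Ω) (S : Set (Ω → EReal))
    (f : Ω → EReal) : Prop :=
  Measurable f ∧ (∀ X ∈ S, X ≤ᵐ[P] f) ∧
    ∀ g : Ω → EReal, Measurable g → (∀ X ∈ S, X ≤ᵐ[P] g) → f ≤ᵐ[P] g

/-- Every family of functions has an essential supremum with respect to a finite measure. -/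
theorem exists_isEssSup {Ω : Type*} {_m0 : MeasurableSpace Ω} (P : Measure Ω) [IsFiniteMeasure P]
    (S : Set (Ω → EReal)) : ∃ f, IsEssSup P S f := by
  classical
  let φ : EReal → ℝ≥0∞ := fun z => (1 + EReal.exp z)⁻¹
  have hφm : Measurable φ := (measurable_const.add EReal.measurable_exp).inv
  have hφa : ∀ a b, a ≤ b → φ b ≤ φ a := fun a b h =>
    ENNReal.inv_le_inv.2 (add_le_add_right (EReal.exp_monotone h) 1)
  have hφs : ∀ a b, φ b ≤ φ a → a ≤ b := fun a b h =>
    EReal.exp_le_exp_iff.1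
      ((ENNReal.add_le_add_iff_left ENNReal.one_ne_top).1 (ENNReal.inv_le_inv.1 h))
  have hφ1 : ∀ a, φ a ≤ 1 := fun a => ENNReal.inv_le_one.2 le_self_add
  let B : Set (Ω → EReal) := {g | Measurable g ∧ ∀ X ∈ S, X ≤ᵐ[P] g}
  have hB : B.Nonempty := ⟨fun _ => ⊤, measurable_const, fun X _ =>
    Filter.Eventually.of_forall fun _ => le_top⟩
  let J : Set ℝ≥0∞ := (fun g : Ω → EReal => ∫⁻ ω, φ (g ω) ∂P) '' B
  obtain ⟨u, -, hu, huJ⟩ := exists_seq_tendsto_sSup (S := J) (hB.image _) (OrderTop.bddAbove J)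
  choose g hgB hgu using huJ
  let f : Ω → EReal := fun ω => ⨅ n, g n ω
  have hf : Measurable f := Measurable.iInf fun n => (hgB n).1
  have hfS : ∀ X ∈ S, X ≤ᵐ[P] f := by
    intro X hX
    filter_upwards [ae_all_iff.2 fun n => (hgB n).2 X hX] with ω hω
    exact le_iInf hω
  have hsup : sSup J ≤ ∫⁻ ω, φ (f ω) ∂P := by
    refine le_of_tendsto' hu fun n => ?_
    rw [← hgu n]
    exact lintegral_mono fun ω => hφa _ _ (iInf_le _ n)
  refine ⟨f, hf, hfS, fun h hh hhS => ?_⟩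
  have hmin : (fun ω => min (f ω) (h ω)) ∈ B := by
    refine ⟨hf.min hh, fun X hX => ?_⟩
    filter_upwards [hfS X hX, hhS X hX] with ω h1 h2
    exact le_min h1 h2
  have hle : ∫⁻ ω, φ (min (f ω) (h ω)) ∂P ≤ ∫⁻ ω, φ (f ω) ∂P :=
    (le_sSup (Set.mem_image_of_mem _ hmin)).trans hsup
  have hfin : ∫⁻ ω, φ (f ω) ∂P ≠ ⊤ := by
    refine ((lintegral_mono fun ω => hφ1 (f ω)).trans_lt ?_).ne
    simp
  have hae := ae_eq_of_ae_le_of_lintegral_le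
    (Filter.Eventually.of_forall fun ω => hφa _ _ (min_le_left (f ω) (h ω))) hfin
    (hφm.comp (hf.min hh)).aemeasurable hle
  filter_upwards [hae] with ω hω
  exact (hφs _ _ hω.ge).trans (min_le_right _ _)

/-- The essential supremum of a family of random variables (unique up to almost sure equality). -/
def essSupFamily {Ω : Type*} {m0 : MeasurableSpace Ω} (P : Measure Ω) [IsFiniteMeasure P]
    (S : Set (Ω → EReal)) : Ω → EReal :=
  (exists_isEssSup P S).choose

theorem essSupFamily_spec {Ω : Type*} {m0 : MeasurableSpace Ω} (P : Measure Ω)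
    [IsFiniteMeasure P] (S : Set (Ω → EReal)) : IsEssSup P S (essSupFamily P S) :=
  (exists_isEssSup P S).choose_spec

/-- The expected-utility variable `E(V(X + ξY)|ℋ)` of the strategy `ξ` from capital `X`. -/
def condUtility {Ω : Type*} (ℋ : MeasurableSpace Ω) {m0 : MeasurableSpace Ω} (P : Measure Ω)
    {d : ℕ} (V : Ω → ℝ → ℝ) (Y : Ω → EuclideanSpace ℝ (Fin d)) (X : Ω → ℝ)
    (ξ : Ω → EuclideanSpace ℝ (Fin d)) : Ω → EReal :=
  genCondExp ℋ P (fun ω => V ω (X ω + inner ℝ (ξ ω) (Y ω)))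

/-- The value `v(X) = ess sup_ξ E(V(X + ξY)|ℋ)`, over all `ℋ`-measurable `ξ`, at a (possibly
random) initial capital `X`. -/
def value {Ω : Type*} (ℋ : MeasurableSpace Ω) {m0 : MeasurableSpace Ω} (P : Measure Ω)
    [IsFiniteMeasure P] {d : ℕ} (V : Ω → ℝ → ℝ) (Y : Ω → EuclideanSpace ℝ (Fin d))
    (X : Ω → ℝ) : Ω → EReal :=
  essSupFamily P {Z | ∃ ξ : Ω → EuclideanSpace ℝ (Fin d), Measurable[ℋ] ξ ∧
    Z = condUtility ℋ P V Y X ξ}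

/-- The same essential supremum, over the `ℋ`-measurable `ξ` with `|ξ| ≤ K` almost surely. -/
def valueBounded {Ω : Type*} (ℋ : MeasurableSpace Ω) {m0 : MeasurableSpace Ω} (P : Measure Ω)
    [IsFiniteMeasure P] {d : ℕ} (V : Ω → ℝ → ℝ) (Y : Ω → EuclideanSpace ℝ (Fin d))
    (K : Ω → ℝ) (X : Ω → ℝ) : Ω → EReal :=
  essSupFamily P {Z | ∃ ξ : Ω → EuclideanSpace ℝ (Fin d), Measurable[ℋ] ξ ∧
    (∀ᵐ ω ∂P, ‖ξ ω‖ ≤ K ω) ∧ Z = condUtility ℋ P V Y X ξ}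

/-- The regular conditional distribution `P(Y ∈ · | ℋ)`: the conditional distribution of `Y`
given the identity map from `Ω` to `(Ω, ℋ)`. -/
def regCondDistrib {Ω : Type*} (ℋ : MeasurableSpace Ω) {m0 : MeasurableSpace Ω} (P : Measure Ω)
    [IsFiniteMeasure P] {d : ℕ} (Y : Ω → EuclideanSpace ℝ (Fin d)) :
    @Kernel Ω (EuclideanSpace ℝ (Fin d)) ℋ _ :=
  @condDistrib Ω Ω (EuclideanSpace ℝ (Fin d)) _ _ _ m0 ℋ Y id P _

/-- `D` is a product-measurable random set, and almost surely `D ω` is a linear subspace which is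
the smallest affine subspace containing the support of `P(Y ∈ · | ℋ)(ω)`. -/
def IsSupportSubspace {Ω : Type*} (ℋ : MeasurableSpace Ω) {m0 : MeasurableSpace Ω}
    (P : Measure Ω) [IsFiniteMeasure P] {d : ℕ} (Y : Ω → EuclideanSpace ℝ (Fin d))
    (D : Ω → Set (EuclideanSpace ℝ (Fin d))) : Prop :=
  MeasurableSet[ℋ.prod inferInstance]
      {p : Ω × EuclideanSpace ℝ (Fin d) | p.2 ∈ D p.1} ∧
    ∀ᵐ ω ∂P, (∃ W : Submodule ℝ (EuclideanSpace ℝ (Fin d)),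
        D ω = (W : Set (EuclideanSpace ℝ (Fin d)))) ∧
      D ω = (affineSpan ℝ (regCondDistrib ℋ P Y ω).support :
        Set (EuclideanSpace ℝ (Fin d)))

end OneStep

end

/-! Gains and losses of a large position compete, and losses win because `γ₁ < γ₂`. Gains: if `X ≤
M`, then `X + ξY ≤ max(1,|ξ|)(M + |Y|)`, so the growth condition with `γ₁` bounds the conditional
expectation of `V⁺` by `max(1,|ξ|)^γ₁ L` (`condLExp_utility_pos_le`). Losses: the events `ξY ≤
-α|ξ|` and `V(-N) < -2C/β - 1` meet with conditional probability at least `β/2`. There, with `T =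
α|ξ| - X` and `n = max(N,1)`, the final position is at most `(T/n)(-n)`, and the condition with `γ₂`
gives `V ≤ -(T/n)^γ₂` once `T ≥ n` (`le_condLExp_utility_neg`).

If `|ξ|` is large, the difference drops below the utility of `ξ = 0`, so `ξ` may be cut to `0`
there; this gives `K`, and finiteness follows. If `X` is very negative, `T` is large for every `ξ`,
which gives `N'`.

The no-arbitrage bound concerns only `ξ ∈ D`, so a general strategy is first replaced by one in `D`
with the same gain (`exists_projection`). Measurability of the projection used there comes from the
mean ergodic theorem. -/

namespace OneStep

/-! ### Conditional expectations with values in `[0, ∞]`: pull-out and locality. -/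

section CondLExp

variable {Ω : Type*} {ℋ m0 : MeasurableSpace Ω} {P : Measure Ω} [IsProbabilityMeasure P]

/-- The pull-out property of the conditional Lebesgue expectation. -/
theorem condLExp_mul_left (hH : ℋ ≤ m0) {c f : Ω → ℝ≥0∞} (hc : Measurable[ℋ] c)
    (hf : AEMeasurable f P) :
    condLExp ℋ P (fun ω => c ω * f ω) =ᵐ[P] fun ω => c ω * condLExp ℋ P f ω := by
  have key : ∀ b : Ω → ℝ≥0∞, Measurable[ℋ] b →
      ∫⁻ ω, b ω * condLExp ℋ P f ω ∂P = ∫⁻ ω, b ω * f ω ∂P := by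
    intro b hb
    have hb' : Measurable b := hb.mono hH le_rfl
    have hE : Measurable (condLExp ℋ P f) := measurable_condLExp' _ _ _
    -- The densities `f` and `condLExp ℋ P f` define measures that agree on `ℋ`, hence integrate
    -- every `ℋ`-measurable `b` alike; no integrability is needed.
    have hν : (P.withDensity (condLExp ℋ P f)).trim hH = (P.withDensity f).trim hH := by
      refine @Measure.ext _ ℋ _ _ fun s hs => ?_
      rw [trim_measurableSet_eq hH hs, trim_measurableSet_eq hH hs,
        withDensity_apply _ (hH s hs), withDensity_apply _ (hH s hs),
        setLIntegral_condLExp hH P f hs]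
    calc ∫⁻ ω, b ω * condLExp ℋ P f ω ∂P
        = ∫⁻ ω, b ω ∂(P.withDensity (condLExp ℋ P f)) := by
          rw [lintegral_withDensity_eq_lintegral_mul₀ hE.aemeasurable hb'.aemeasurable]
          exact lintegral_congr fun ω => mul_comm _ _
      _ = ∫⁻ ω, b ω ∂(P.withDensity f) := by
          rw [← lintegral_trim hH hb, hν, lintegral_trim hH hb]
      _ = ∫⁻ ω, b ω * f ω ∂P := by
          rw [lintegral_withDensity_eq_lintegral_mul₀ hf hb'.aemeasurable]
          exact lintegral_congr fun ω => mul_comm _ _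
  refine (ae_eq_condLExp hH P _ (hc.mul (measurable_condLExp _ _ _)) fun s hs => ?_).symm
  have h := key (s.indicator c) (hc.indicator hs)
  rw [← lintegral_indicator (hH s hs), ← lintegral_indicator (hH s hs)]
  refine Eq.trans (lintegral_congr fun ω => ?_) (h.trans (lintegral_congr fun ω => ?_)) <;>
  · by_cases hω : ω ∈ s <;> simp [hω]

/-- The conditional Lebesgue expectation is monotone locally on sets of the conditioning
σ-algebra. -/
theorem condLExp_mono_on (hH : ℋ ≤ m0) {s : Set Ω} (hs : MeasurableSet[ℋ] s)
    {f g : Ω → ℝ≥0∞} (h : ∀ᵐ ω ∂P, ω ∈ s → f ω ≤ g ω) :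
    ∀ᵐ ω ∂P, ω ∈ s → condLExp ℋ P f ω ≤ condLExp ℋ P g ω := by
  have key : ∀ u : Ω → ℝ≥0∞,
      s.indicator (condLExp ℋ P u) =ᵐ[P] condLExp ℋ P (s.indicator u) := by
    intro u
    refine ae_eq_condLExp hH P _ ((measurable_condLExp _ _ _).indicator hs) fun t ht => ?_
    rw [setLIntegral_indicator (hH s hs), setLIntegral_indicator (hH s hs),
      setLIntegral_condLExp hH P u (hs.inter ht)]
  have hle : s.indicator f ≤ᵐ[P] s.indicator g := by
    filter_upwards [h] with ω hω
    by_cases hs : ω ∈ s <;> simp [hs, hω]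
  filter_upwards [key f, key g, condLExp_mono (mΩ := ℋ) hle] with ω h1 h2 h3 hω
  rw [← h1, ← h2] at h3
  simpa [hω] using h3

/-- A lower bound for a conditional probability, in terms of the conditional Lebesgue
expectation. -/
theorem ofReal_le_condLExp_indicator {s : Set Ω} (hs : NullMeasurableSet s P) {b : Ω → ℝ}
    (h : ∀ᵐ ω ∂P, b ω ≤ (P[s.indicator (fun _ => (1 : ℝ)) | ℋ]) ω) :
    ∀ᵐ ω ∂P, ENNReal.ofReal (b ω) ≤ condLExp ℋ P (s.indicator fun _ => 1) ω := by
  have hint : Integrable (s.indicator (fun _ => (1 : ℝ))) P :=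
    (integrable_const (1 : ℝ)).indicator₀ hs
  have hnn : 0 ≤ᵐ[P] s.indicator (fun _ => (1 : ℝ)) :=
    Filter.Eventually.of_forall fun ω => Set.indicator_nonneg (fun _ _ => zero_le_one) ω
  have heq : (fun ω => ENNReal.ofReal (s.indicator (fun _ => (1 : ℝ)) ω))
      = s.indicator fun _ => 1 := by
    funext ω
    by_cases hω : ω ∈ s <;> simp [hω]
  have h2 := condLExp_ofReal ℋ hint hnn
  rw [heq] at h2
  filter_upwards [h, h2] with ω h1 h2
  rw [h2]
  exact ENNReal.ofReal_le_ofReal h1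

/-- If two events have conditional probabilities at least `b` and `1 - b / 2`, then their
intersection has conditional probability at least `b / 2`. -/
theorem ofReal_half_le_condLExp_inter (hH : ℋ ≤ m0) {s t : Set Ω} (hs : NullMeasurableSet s P)
    (ht : NullMeasurableSet t P) {b : Ω → ℝ} (hb : ∀ᵐ ω ∂P, 0 < b ω)
    (h1 : ∀ᵐ ω ∂P, b ω ≤ (P[s.indicator (fun _ => (1 : ℝ)) | ℋ]) ω)
    (h2 : ∀ᵐ ω ∂P, 1 - b ω / 2 ≤ (P[t.indicator (fun _ => (1 : ℝ)) | ℋ]) ω) :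
    ∀ᵐ ω ∂P, b ω ≤ 1 ∧
      ENNReal.ofReal (b ω / 2) ≤ condLExp ℋ P ((s ∩ t).indicator fun _ => 1) ω := by
  have hs1 : AEMeasurable (s.indicator fun _ => (1 : ℝ≥0∞)) P :=
    aemeasurable_const.indicator₀ hs
  have hone : AEMeasurable (1 : Ω → ℝ≥0∞) P := aemeasurable_const
  have hle1 : condLExp ℋ P (s.indicator fun _ => 1) ≤ᵐ[P] condLExp ℋ P 1 :=
    condLExp_mono (Filter.Eventually.of_forall fun ω =>
      Set.indicator_le_self' (fun _ _ => zero_le) ω)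
  -- Inclusion-exclusion in additive form, which avoids subtraction in `ℝ≥0∞`.
  have hle2 : condLExp ℋ P ((s.indicator fun _ => 1) + t.indicator fun _ => 1) ≤ᵐ[P]
      condLExp ℋ P (1 + (s ∩ t).indicator fun _ => 1) := by
    refine condLExp_mono (Filter.Eventually.of_forall fun ω => ?_)
    by_cases hω : ω ∈ s <;> by_cases hω' : ω ∈ t <;> simp [hω, hω']
  filter_upwards [ofReal_le_condLExp_indicator hs h1, ofReal_le_condLExp_indicator ht h2, hb,
    hle1, hle2, condLExp_add_left (mΩ := ℋ) (t.indicator fun _ => 1) hs1,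
    condLExp_add_left (mΩ := ℋ) ((s ∩ t).indicator fun _ => 1) hone] with ω a1 a2 hb a3 a4 a5 a6
  rw [a5, a6] at a4
  simp only [condLExp_one hH P, Pi.add_apply, Pi.one_apply] at a3 a4
  have hb1 : b ω ≤ 1 := by
    simpa using a1.trans a3
  refine ⟨hb1, ?_⟩
  have a7 : ENNReal.ofReal (b ω) + ENNReal.ofReal (1 - b ω / 2) ≤
      1 + condLExp ℋ P ((s ∩ t).indicator fun _ => 1) ω := (add_le_add a1 a2).trans a4
  rw [← ENNReal.ofReal_add hb.le (by linarith),
    show b ω + (1 - b ω / 2) = 1 + b ω / 2 by ring,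
    ENNReal.ofReal_add zero_le_one (by linarith), ENNReal.ofReal_one] at a7
  exact (ENNReal.add_le_add_iff_left ENNReal.one_ne_top).1 a7

/-- The generalized conditional expectation is local on sets of the conditioning σ-algebra. -/
theorem genCondExp_congr_on (hH : ℋ ≤ m0) {s : Set Ω} (hs : MeasurableSet[ℋ] s)
    {Z Z' : Ω → ℝ} (h : ∀ᵐ ω ∂P, ω ∈ s → Z ω = Z' ω) :
    ∀ᵐ ω ∂P, ω ∈ s → genCondExp ℋ P Z ω = genCondExp ℋ P Z' ω := by
  have key : ∀ φ : ℝ → ℝ≥0∞, ∀ᵐ ω ∂P, ω ∈ s →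
      condLExp ℋ P (fun ω => φ (Z ω)) ω = condLExp ℋ P (fun ω => φ (Z' ω)) ω := by
    intro φ
    filter_upwards [
      condLExp_mono_on (f := fun ω => φ (Z ω)) (g := fun ω => φ (Z' ω)) hH hs
        (h.mono fun ω h hω => by rw [h hω]),
      condLExp_mono_on (f := fun ω => φ (Z' ω)) (g := fun ω => φ (Z ω)) hH hs
        (h.mono fun ω h hω => by rw [h hω])] with ω h1 h2 hω
    exact le_antisymm (h1 hω) (h2 hω)
  filter_upwards [key fun z => ENNReal.ofReal z, key fun z => ENNReal.ofReal (-z)] with ω h1 h2 hω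
  simp only [genCondExp, h1 hω, h2 hω]

theorem genCondExp_congr_ae (hH : ℋ ≤ m0) {Z Z' : Ω → ℝ} (h : Z =ᵐ[P] Z') :
    genCondExp ℋ P Z =ᵐ[P] genCondExp ℋ P Z' := by
  filter_upwards [genCondExp_congr_on hH (s := Set.univ) (@MeasurableSet.univ _ ℋ)
    (h.mono fun ω h _ => h)] with ω h
  exact h trivial

end CondLExp

/-! ### Measurable projection through a normalized second moment operator. -/

section RankOne

variable {E : Type*} [NormedAddCommGroup E] [InnerProductSpace ℝ E]

/-- The rank-one operator `v ↦ ⟪y, v⟫ y / (1 + |y|²)`. -/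
noncomputable def normalizedRankOne (y : E) : E →L[ℝ] E :=
  (1 + ‖y‖ ^ 2)⁻¹ • (innerSL ℝ y).smulRight y

theorem inner_normalizedRankOne (y v u : E) :
    inner ℝ (normalizedRankOne y v) u = (1 + ‖y‖ ^ 2)⁻¹ * (inner ℝ y v * inner ℝ y u) := by
  simp [normalizedRankOne, inner_smul_left]

theorem norm_normalizedRankOne_le (y : E) : ‖normalizedRankOne y‖ ≤ 1 := by
  have h : 0 < 1 + ‖y‖ ^ 2 := by positivity
  rw [normalizedRankOne, norm_smul, ContinuousLinearMap.norm_smulRight_apply, innerSL_apply_norm,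
    Real.norm_of_nonneg (inv_nonneg.2 h.le), inv_mul_le_one₀ h]
  nlinarith

theorem continuous_normalizedRankOne : Continuous (normalizedRankOne (E := E)) := by
  have h : ∀ y : E, 1 + ‖y‖ ^ 2 ≠ 0 := fun y => by positivity
  refine Continuous.smul (Continuous.inv₀ (by fun_prop) h) ?_
  exact ((ContinuousLinearMap.smulRightL ℝ E E).continuous₂).comp
    ((innerSL ℝ (E := E)).continuous.prodMk continuous_id)

end RankOne

section Projection

variable {E : Type*} [NormedAddCommGroup E] [InnerProductSpace ℝ E] [FiniteDimensional ℝ E]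
  [MeasurableSpace E] [BorelSpace E]

/-- The normalized second moment operator `v ↦ ∫ ⟪y, v⟫ y / (1 + |y|²) dμ(y)`. Its kernel consists
of the vectors that are orthogonal to `μ`-almost every `y`. -/
noncomputable def momentOperator (μ : Measure E) : E →L[ℝ] E :=
  ∫ y, normalizedRankOne y ∂μ

theorem integrable_normalizedRankOne (μ : Measure E) [IsProbabilityMeasure μ] :
    Integrable (fun y : E => normalizedRankOne y) μ :=
  Integrable.of_bound continuous_normalizedRankOne.aestronglyMeasurable 1
    (Filter.Eventually.of_forall norm_normalizedRankOne_le)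

theorem inner_momentOperator (μ : Measure E) [IsProbabilityMeasure μ] (v u : E) :
    inner ℝ (momentOperator μ v) u
      = ∫ y, (1 + ‖y‖ ^ 2)⁻¹ * (inner ℝ y v * inner ℝ y u) ∂μ := by
  have hi := integrable_normalizedRankOne μ
  rw [momentOperator, ContinuousLinearMap.integral_apply hi, real_inner_comm,
    ← integral_inner (hi.apply_continuousLinearMap v)]
  refine integral_congr_ae (Filter.Eventually.of_forall fun y => ?_)
  simp only
  rw [real_inner_comm, inner_normalizedRankOne]

theorem integrable_inner_mul_inner (μ : Measure E) [IsProbabilityMeasure μ] (v u : E) :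
    Integrable (fun y : E => (1 + ‖y‖ ^ 2)⁻¹ * (inner ℝ y v * inner ℝ y u)) μ := by
  have := ((integrable_normalizedRankOne μ).apply_continuousLinearMap v).inner_const (𝕜 := ℝ) u
  simpa only [inner_normalizedRankOne] using this

/-- This is `A² ≤ A` for a positive symmetric contraction `A`. With `w = Av`, the pointwise
inequality `2ab ≤ a² + b²` gives `|w|² = ⟪Av, w⟫ ≤ (⟪Av, v⟫ + ⟪Aw, w⟫)/2`, and `⟪Aw, w⟫ ≤ |w|²`. -/
theorem norm_momentOperator_sq_le (μ : Measure E) [IsProbabilityMeasure μ] (v : E) :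
    ‖momentOperator μ v‖ ^ 2 ≤ inner ℝ (momentOperator μ v) v := by
  set w := momentOperator μ v with hw
  have hww : inner ℝ (momentOperator μ w) w ≤ ‖w‖ ^ 2 := by
    have h1 : ‖momentOperator μ‖ ≤ 1 := by
      refine (norm_integral_le_of_norm_le_const
        (Filter.Eventually.of_forall norm_normalizedRankOne_le)).trans ?_
      simp
    calc inner ℝ (momentOperator μ w) w ≤ ‖momentOperator μ w‖ * ‖w‖ := real_inner_le_norm _ _
      _ ≤ (1 * ‖w‖) * ‖w‖ := by gcongr; exact (momentOperator μ).le_of_opNorm_le h1 w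
      _ = ‖w‖ ^ 2 := by ring
  have hcs : inner ℝ w w ≤
      (inner ℝ (momentOperator μ v) v + inner ℝ (momentOperator μ w) w) / 2 := by
    conv_lhs => rw [hw]
    rw [← hw, inner_momentOperator, inner_momentOperator, inner_momentOperator,
      ← integral_add (integrable_inner_mul_inner μ v v) (integrable_inner_mul_inner μ w w),
      ← integral_div]
    refine integral_mono (integrable_inner_mul_inner μ v w)
      (((integrable_inner_mul_inner μ v v).add (integrable_inner_mul_inner μ w w)).div_const 2)
      fun y => ?_
    have hp : 0 ≤ (1 + ‖y‖ ^ 2)⁻¹ := by positivity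
    simp only
    nlinarith [mul_nonneg hp (sq_nonneg (inner ℝ y v - inner ℝ y w : ℝ))]
  rw [real_inner_self_eq_norm_sq] at hcs
  linarith

/-- Expanding the square, `|v - Av|² = |v|² - 2⟪Av, v⟫ + |Av|² ≤ |v|²`. The mean ergodic theorem
requires this contraction property. -/
theorem norm_one_sub_momentOperator_le (μ : Measure E) [IsProbabilityMeasure μ] :
    ‖(1 : E →L[ℝ] E) - momentOperator μ‖ ≤ 1 := by
  refine ContinuousLinearMap.opNorm_le_bound _ zero_le_one fun v => ?_
  rw [one_mul]
  refine le_of_sq_le_sq ?_ (norm_nonneg v)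
  have h := norm_momentOperator_sq_le μ v
  have h2 := norm_sub_sq_real v (momentOperator μ v)
  rw [real_inner_comm] at h2
  have h3 : 0 ≤ ‖momentOperator μ v‖ ^ 2 := by positivity
  simp only [_root_.sub_apply, one_apply_eq_self]
  linarith

theorem momentOperator_eq_zero_iff (μ : Measure E) [IsProbabilityMeasure μ] (v : E) :
    momentOperator μ v = 0 ↔ ∀ᵐ y ∂μ, inner ℝ y v = 0 := by
  constructor
  · intro h
    have h0 := inner_momentOperator μ v v
    rw [h, inner_zero_left] at h0
    have h1 := (integral_eq_zero_iff_of_nonneg (fun y => by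
      have := mul_self_nonneg (inner ℝ y v : ℝ); simp only [Pi.zero_apply]; positivity)
      (integrable_inner_mul_inner μ v v)).1 h0.symm
    filter_upwards [h1] with y hy
    have hp : (1 + ‖y‖ ^ 2)⁻¹ ≠ 0 := by positivity
    simpa [hp] using hy
  · intro h
    rw [← inner_self_eq_zero (𝕜 := ℝ), inner_momentOperator]
    refine integral_eq_zero_of_ae ?_
    filter_upwards [h] with y hy
    simp [hy]

/-- The projection onto the kernel of the moment operator depends measurably on the measure, as a
limit of Birkhoff averages. -/
theorem measurable_orthogonalProjection_ker_momentOperator {Ω : Type*} [MeasurableSpace Ω]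
    (κ : Kernel Ω E) [IsMarkovKernel κ] {ξ : Ω → E} (hξ : Measurable ξ) :
    Measurable fun ω => (((momentOperator (κ ω)).ker).orthogonalProjectionOnto (ξ ω) : E) := by
  have hA : StronglyMeasurable fun ω => momentOperator (κ ω) :=
    continuous_normalizedRankOne.stronglyMeasurable.integral_kernel
  have hiter : ∀ n : ℕ, StronglyMeasurable
      fun ω => (((1 : E →L[ℝ] E) - momentOperator (κ ω) : E →L[ℝ] E))^[n] (ξ ω) := by
    intro n
    induction n with
    | zero => exact hξ.stronglyMeasurable
    | succ n ih =>
      simp only [Function.iterate_succ_apply']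
      exact (isBoundedBilinearMap_apply (𝕜 := ℝ) (E := E)
        (F := E)).continuous.comp_stronglyMeasurable
        ((stronglyMeasurable_const.sub hA).prodMk ih)
  have hlim : ∀ ω, Filter.Tendsto (fun n => birkhoffAverage ℝ
      ((1 : E →L[ℝ] E) - momentOperator (κ ω) : E →L[ℝ] E) _root_.id n (ξ ω)) Filter.atTop
      (nhds (((momentOperator (κ ω)).ker).orthogonalProjectionOnto (ξ ω) : E)) := by
    intro ω
    have h := ContinuousLinearMap.tendsto_birkhoffAverage_orthogonalProjection (𝕜 := ℝ) _
      (norm_one_sub_momentOperator_le (κ ω)) (ξ ω)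
    -- The fixed points of `1 - A` form the kernel of `A`, so the ergodic limit is the projection
    -- onto that kernel.
    have hk : LinearMap.eqLocus (((1 : E →L[ℝ] E) - momentOperator (κ ω) : E →L[ℝ] E) : E →ₗ[ℝ] E)
        ((1 : E →L[ℝ] E) : E →ₗ[ℝ] E) = (momentOperator (κ ω)).ker := by
      ext v; simp
    have hproj : ∀ (K L : Submodule ℝ E), K = L →
        (K.orthogonalProjectionOnto (ξ ω) : E) = L.orthogonalProjectionOnto (ξ ω) := by
      rintro K _ rfl; rfl
    rw [hproj _ _ hk] at h
    exact h
  refine measurable_of_tendsto_metrizable (fun n => ?_) (tendsto_pi_nhds.2 hlim)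
  refine StronglyMeasurable.measurable ?_
  simp only [birkhoffAverage, birkhoffSum, id]
  exact (Finset.stronglyMeasurable_fun_sum _ fun i _ => hiter i).const_smul _

end Projection

/-- A property that holds almost surely for the regular conditional distribution of `Y` given
`X = b`, for every `b`, holds almost surely for the pair `(X, Y)`. -/
theorem ae_of_forall_condDistrib {Ω β E : Type*} [MeasurableSpace E] [StandardBorelSpace E]
    [Nonempty E] {m0 : MeasurableSpace Ω} {mβ : MeasurableSpace β} {P : Measure Ω}
    [IsFiniteMeasure P] {X : Ω → β} {Y : Ω → E} (hX : Measurable X) (hY : Measurable Y)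
    {p : β × E → Prop} (hp : MeasurableSet {z | p z})
    (h : ∀ b, ∀ᵐ y ∂condDistrib Y X P b, p (b, y)) : ∀ᵐ ω ∂P, p (X ω, Y ω) := by
  have h1 : ∀ᵐ z ∂(P.map fun ω => (X ω, Y ω)), p z := by
    rw [← compProd_map_condDistrib hY.aemeasurable]
    exact (Measure.ae_compProd_iff hp).2 (Filter.Eventually.of_forall h)
  exact ae_of_ae_map (hX.prodMk hY).aemeasurable h1

/-- Every `ℋ`-measurable strategy can be projected onto the support subspace `D` without changing
its gain. -/
theorem exists_projection {Ω : Type*} {ℋ m0 : MeasurableSpace Ω} {P : Measure Ω}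
    [IsProbabilityMeasure P] (hH : ℋ ≤ m0) {d : ℕ} {Y : Ω → EuclideanSpace ℝ (Fin d)}
    (hY : Measurable Y) {D : Ω → Set (EuclideanSpace ℝ (Fin d))}
    (hD : IsSupportSubspace ℋ P Y D) {ξ : Ω → EuclideanSpace ℝ (Fin d)}
    (hξ : Measurable[ℋ] ξ) :
    ∃ η : Ω → EuclideanSpace ℝ (Fin d), Measurable[ℋ] η ∧ (∀ᵐ ω ∂P, η ω ∈ D ω) ∧
      ∀ᵐ ω ∂P, (inner ℝ (η ω) (Y ω) : ℝ) = inner ℝ (ξ ω) (Y ω) := by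
  set κ := regCondDistrib ℋ P Y with hκ
  have hM : @IsMarkovKernel Ω (EuclideanSpace ℝ (Fin d)) ℋ _ κ := by
    rw [hκ]; unfold regCondDistrib; infer_instance
  set q : Ω → EuclideanSpace ℝ (Fin d) := fun ω =>
    ((momentOperator (κ ω)).ker).orthogonalProjectionOnto (ξ ω) with hq
  have hqm : Measurable[ℋ] q :=
    @measurable_orthogonalProjection_ker_momentOperator _ _ _ _ _ _ Ω ℋ κ hM ξ hξ
  have hprob : ∀ ω, IsProbabilityMeasure (κ ω) := fun ω => hM.isProbabilityMeasure ω
  -- For every `ω`, `q ω` lies in the kernel, hence is orthogonal to `κ ω`-almost every `y`;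
  -- disintegration transfers this to `Y ω`.
  have hq0 : ∀ᵐ ω ∂P, inner ℝ (Y ω) (q ω) = (0 : ℝ) := by
    have hid : @Measurable Ω Ω m0 ℋ id := measurable_id'' hH
    have hset : @MeasurableSet _ (@Prod.instMeasurableSpace _ _ ℋ _)
        {p : Ω × EuclideanSpace ℝ (Fin d) | inner ℝ p.2 (q p.1) = (0 : ℝ)} := by
      refine measurableSet_eq_fun ?_ measurable_const
      exact Measurable.inner measurable_snd (hqm.comp measurable_fst)
    refine @ae_of_forall_condDistrib Ω Ω _ _ _ _ m0 ℋ P _ id Y hid hY _ hset fun ω => ?_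
    have := hprob ω
    refine (momentOperator_eq_zero_iff (κ ω) (q ω)).1 ?_
    exact (((momentOperator (κ ω)).ker).orthogonalProjectionOnto (ξ ω)).2
  refine ⟨fun ω => ξ ω - q ω, hξ.sub hqm, ?_, ?_⟩
  · filter_upwards [hD.2] with ω hω
    obtain ⟨⟨W, hW⟩, hspan⟩ := hω
    rw [hW, SetLike.mem_coe]
    have hperp : ξ ω - q ω ∈ ((momentOperator (κ ω)).ker)ᗮ :=
      Submodule.sub_starProjection_mem_orthogonal _
    -- It suffices that `Wᗮ` lies in the kernel: `W` contains the support of `κ ω`, which carries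
    -- the whole mass.
    rw [← W.orthogonal_orthogonal]
    refine Submodule.orthogonal_le (fun v hv => ?_) hperp
    have := hprob ω
    rw [LinearMap.mem_ker]
    refine (momentOperator_eq_zero_iff (κ ω) v).2 ?_
    filter_upwards [Measure.support_mem_ae (μ := κ ω)] with y hy
    refine W.mem_orthogonal v |>.1 hv y ?_
    rw [← SetLike.mem_coe, ← hW, hspan]
    exact subset_affineSpan ℝ _ hy
  · filter_upwards [hq0] with ω hω
    rw [inner_sub_left, real_inner_comm, real_inner_comm _ (q ω), hω, sub_zero]

/-- Superposition of a Carathéodory function with a random variable. -/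
theorem aemeasurable_comp_caratheodory {Ω : Type*} {m0 : MeasurableSpace Ω} {P : Measure Ω}
    {V : Ω → ℝ → ℝ} (hV : ∀ᵐ ω ∂P, Continuous (V ω)) (hVm : ∀ x, Measurable fun ω => V ω x)
    {Z : Ω → ℝ} (hZ : AEMeasurable Z P) : AEMeasurable (fun ω => V ω (Z ω)) P := by
  classical
  -- Setting `V` to zero on a measurable null set makes all paths continuous, hence the modification
  -- jointly measurable.
  obtain ⟨G, hGsub, hGm, hG⟩ := exists_measurable_superset_of_null (ae_iff.1 hV)
  have hu : Measurable (Function.uncurry fun (x : ℝ) (ω : Ω) => if ω ∈ G then 0 else V ω x) := by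
    refine measurable_uncurry_of_continuous_of_measurable (fun ω => ?_) fun x => ?_
    · by_cases hω : ω ∈ G
      · simp only [hω, if_true]; exact continuous_const
      · simp only [hω, if_false]
        by_contra hc
        exact hω (hGsub hc)
    · exact Measurable.ite hGm measurable_const (hVm x)
  refine (hu.comp_aemeasurable (hZ.prodMk aemeasurable_id)).congr ?_
  filter_upwards [measure_eq_zero_iff_ae_notMem.1 hG] with ω hω
  simp [hω]

/-- The positive part has a finite bound, so `∞ - ∞` cannot occur; the negative part may be
infinite. -/
theorem genCondExp_le_of_le {Ω : Type*} {ℋ m0 : MeasurableSpace Ω} {P : Measure Ω}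
    {Z : Ω → ℝ} {ω : Ω} {a b : ℝ} (ha : 0 ≤ a) (hb : 0 ≤ b)
    (h1 : condLExp ℋ P (fun ω => ENNReal.ofReal (Z ω)) ω ≤ ENNReal.ofReal a)
    (h2 : ENNReal.ofReal b ≤ condLExp ℋ P (fun ω => ENNReal.ofReal (-Z ω)) ω) :
    genCondExp ℋ P Z ω ≤ ((a - b : ℝ) : EReal) := by
  rw [genCondExp, EReal.coe_sub]
  refine EReal.sub_le_sub ?_ ?_
  · simpa [EReal.coe_ennreal_ofReal, ha] using EReal.coe_ennreal_le_coe_ennreal_iff.2 h1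
  · simpa [EReal.coe_ennreal_ofReal, hb] using EReal.coe_ennreal_le_coe_ennreal_iff.2 h2

/-! ### Growth of conditional gains and losses. -/

section Estimates

variable {Ω : Type*} {ℋ m0 : MeasurableSpace Ω} {P : Measure Ω} [IsProbabilityMeasure P]
  {d : ℕ} {Y : Ω → EuclideanSpace ℝ (Fin d)} {V : Ω → ℝ → ℝ}

/-- The conditional expectation of the positive part of the utility grows at most like
`max(1, |ξ|) ^ γ`. -/
theorem condLExp_utility_pos_le (hH : ℋ ≤ m0) (hY : Measurable Y)
    (hV : ∀ᵐ ω ∂P, Monotone (V ω) ∧ Continuous (V ω)) (hVm : ∀ x, Measurable fun ω => V ω x)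
    {C γ : ℝ} (hC : 0 < C)
    (hgrowth : ∀ᵐ ω ∂P, ∀ x l : ℝ, 1 ≤ l → V ω (l * x) ≤ l ^ γ * V ω x + C * l ^ γ)
    {M : ℝ} (hM : 0 ≤ M)
    (hfin : ∀ᵐ ω ∂P, condLExp ℋ P (fun ω => ENNReal.ofReal (V ω (M + ‖Y ω‖))) ω < ⊤)
    {X : Ω → ℝ} (hX : ∀ᵐ ω ∂P, X ω ≤ M)
    {ξ : Ω → EuclideanSpace ℝ (Fin d)} (hξ : Measurable[ℋ] ξ) :
    ∀ᵐ ω ∂P,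
      condLExp ℋ P (fun ω => ENNReal.ofReal (V ω (X ω + inner ℝ (ξ ω) (Y ω)))) ω ≤
        ENNReal.ofReal (max 1 ‖ξ ω‖ ^ γ *
          ((condLExp ℋ P (fun ω => ENNReal.ofReal (V ω (M + ‖Y ω‖))) ω).toReal + C)) := by
  have hr : Measurable[ℋ] fun ω => ENNReal.ofReal (max 1 ‖ξ ω‖ ^ γ) :=
    ((measurable_const.max (measurable_norm.comp hξ)).pow_const γ).ennreal_ofReal
  have hg : AEMeasurable (fun ω => ENNReal.ofReal (V ω (M + ‖Y ω‖))) P :=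
    (aemeasurable_comp_caratheodory (hV.mono fun _ h => h.2) hVm
      (measurable_const.add hY.norm).aemeasurable).ennreal_ofReal
  have hle : (fun ω => ENNReal.ofReal (V ω (X ω + inner ℝ (ξ ω) (Y ω)))) ≤ᵐ[P]
      fun ω => ENNReal.ofReal (max 1 ‖ξ ω‖ ^ γ) *
        ((fun ω => ENNReal.ofReal (V ω (M + ‖Y ω‖))) + (fun _ => ENNReal.ofReal C) :
          Ω → ℝ≥0∞) ω := by
    filter_upwards [hV, hgrowth, hX] with ω hV hg hX
    have h1 : (1 : ℝ) ≤ max 1 ‖ξ ω‖ := le_max_left _ _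
    have h0 : 0 ≤ max 1 ‖ξ ω‖ ^ γ := by positivity
    have h2 : X ω + inner ℝ (ξ ω) (Y ω) ≤ max 1 ‖ξ ω‖ * (M + ‖Y ω‖) := by
      have h3 : inner ℝ (ξ ω) (Y ω) ≤ ‖ξ ω‖ * ‖Y ω‖ := real_inner_le_norm _ _
      have h4 : ‖ξ ω‖ * ‖Y ω‖ ≤ max 1 ‖ξ ω‖ * ‖Y ω‖ := by gcongr; exact le_max_right _ _
      nlinarith
    have h5 : V ω (X ω + inner ℝ (ξ ω) (Y ω)) ≤ max 1 ‖ξ ω‖ ^ γ * (V ω (M + ‖Y ω‖) + C) := by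
      have := (hV.1 h2).trans (hg _ _ h1)
      linarith
    simp only [Pi.add_apply]
    refine (ENNReal.ofReal_le_ofReal h5).trans ?_
    rw [ENNReal.ofReal_mul h0]
    gcongr
    exact ENNReal.ofReal_add_le
  have hpull := condLExp_mul_left hH hr (hg.add (aemeasurable_const (b := ENNReal.ofReal C)))
  filter_upwards [condLExp_mono (mΩ := ℋ) hle, hpull,
    condLExp_add_left (mΩ := ℋ) (fun _ => ENNReal.ofReal C) hg, hfin] with ω h1 h2 h3 h4
  refine h1.trans ?_
  rw [h2, h3, Pi.add_apply, condLExp_const hH, ENNReal.ofReal_mul (by positivity),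
    ENNReal.ofReal_add ENNReal.toReal_nonneg hC.le, ENNReal.ofReal_toReal h4.ne]

/-- The conditional expectation of the negative part of the utility grows at least like
`(α|ξ| - X) ^ γ` for strategies in `D`. -/
theorem le_condLExp_utility_neg (hH : ℋ ≤ m0) (hY : Measurable Y)
    (hV : ∀ᵐ ω ∂P, Monotone (V ω) ∧ Continuous (V ω)) (hVm : ∀ x, Measurable fun ω => V ω x)
    {C γ : ℝ} (hC : 0 < C)
    (hgrowth : ∀ᵐ ω ∂P, ∀ x l : ℝ, 1 ≤ l → V ω (l * x) ≤ l ^ γ * V ω x + C * l ^ γ)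
    {α β N : Ω → ℝ} (hα : Measurable[ℋ] α) (hβpos : ∀ᵐ ω ∂P, 0 < β ω) (hN : Measurable[ℋ] N)
    (hVN : ∀ᵐ ω ∂P, 1 - β ω / 2 ≤
      (P[{ω' | V ω' (-N ω') < -(2 * C / β ω') - 1}.indicator (fun _ => (1 : ℝ)) | ℋ]) ω)
    (hβ : Measurable[ℋ] β)
    {X : Ω → ℝ} (hX : Measurable[ℋ] X)
    {ξ : Ω → EuclideanSpace ℝ (Fin d)} (hξ : Measurable[ℋ] ξ)
    (hNA : ∀ᵐ ω ∂P, β ω ≤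
        (P[{ω' | inner ℝ (ξ ω') (Y ω') ≤ -α ω' * ‖ξ ω'‖}.indicator (fun _ => (1 : ℝ)) | ℋ]) ω) :
    ∀ᵐ ω ∂P, max (N ω) 1 ≤ α ω * ‖ξ ω‖ - X ω →
      ENNReal.ofReal (β ω / 2 * ((α ω * ‖ξ ω‖ - X ω) / max (N ω) 1) ^ γ) ≤
        condLExp ℋ P (fun ω => ENNReal.ofReal (-V ω (X ω + inner ℝ (ξ ω) (Y ω)))) ω := by
  have hξ' := hξ.mono hH le_rfl
  have hs : NullMeasurableSet {ω' | inner ℝ (ξ ω') (Y ω') ≤ -α ω' * ‖ξ ω'‖} P :=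
    (measurableSet_le (hξ'.inner hY)
      ((hα.mono hH le_rfl).neg.mul hξ'.norm)).nullMeasurableSet
  have ht : NullMeasurableSet {ω' | V ω' (-N ω') < -(2 * C / β ω') - 1} P :=
    nullMeasurableSet_lt (aemeasurable_comp_caratheodory (hV.mono fun _ h => h.2) hVm
      (hN.mono hH le_rfl).neg.aemeasurable)
      (((measurable_const.div (hβ.mono hH le_rfl)).neg.sub_const 1).aemeasurable)
  set T : Ω → ℝ := fun ω => α ω * ‖ξ ω‖ - X ω with hT
  have hTm : Measurable[ℋ] T := (hα.mul (measurable_norm.comp hξ)).sub hX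
  have hNm : Measurable[ℋ] fun ω => max (N ω) 1 := hN.max measurable_const
  have hB : MeasurableSet[ℋ] {ω | max (N ω) 1 ≤ T ω} := measurableSet_le hNm hTm
  -- The cut-off to `T ≥ max (N ω) 1` is in `ℋ`, so the whole factor can be pulled out of the
  -- conditional expectation.
  set c : Ω → ℝ≥0∞ := {ω | max (N ω) 1 ≤ T ω}.indicator
    (fun ω => ENNReal.ofReal ((T ω / max (N ω) 1) ^ γ)) with hc
  have hcm : Measurable[ℋ] c :=
    Measurable.indicator ((hTm.div hNm).pow_const γ).ennreal_ofReal hB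
  have hprob := ofReal_half_le_condLExp_inter hH hs ht hβpos hNA hVN
  have hle : (fun ω => c ω * (({ω' | inner ℝ (ξ ω') (Y ω') ≤ -α ω' * ‖ξ ω'‖} ∩
      {ω' | V ω' (-N ω') < -(2 * C / β ω') - 1}).indicator fun _ => 1) ω) ≤ᵐ[P]
      fun ω => ENNReal.ofReal (-V ω (X ω + inner ℝ (ξ ω) (Y ω))) := by
    filter_upwards [hV, hgrowth, hprob, hβpos] with ω hV hg hb hβp
    by_cases h1 : ω ∈ {ω | max (N ω) 1 ≤ T ω}
    swap
    · simp only [hc, Set.indicator_of_notMem h1, zero_mul, zero_le]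
    by_cases h2 : ω ∈ {ω' | inner ℝ (ξ ω') (Y ω') ≤ -α ω' * ‖ξ ω'‖} ∩
      {ω' | V ω' (-N ω') < -(2 * C / β ω') - 1}
    swap
    · simp only [Set.indicator_of_notMem h2, mul_zero, zero_le]
    simp only [hc, Set.indicator_of_mem h1, Set.indicator_of_mem h2, mul_one]
    refine ENNReal.ofReal_le_ofReal ?_
    have hn : 0 < max (N ω) 1 := lt_max_of_lt_right one_pos
    have hl : 1 ≤ T ω / max (N ω) 1 := (one_le_div hn).2 h1
    have hp : 0 ≤ (T ω / max (N ω) 1) ^ γ := by positivity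
    -- Since `β ≤ 1`, the level `2C/β` exceeds `C`; thus `V(-n) + C ≤ -1` and the error term of the
    -- growth condition is absorbed.
    have h3 : V ω (-max (N ω) 1) ≤ -C - 1 := by
      have h4 : V ω (-max (N ω) 1) ≤ V ω (-N ω) := hV.1 (neg_le_neg (le_max_left _ _))
      have h5 := h2.2
      have h6 : C ≤ 2 * C / β ω := by
        rw [le_div_iff₀ hβp]; nlinarith [hb.1]
      simp only [Set.mem_ofPred_eq] at h5
      linarith
    have h7 : X ω + inner ℝ (ξ ω) (Y ω) ≤ T ω / max (N ω) 1 * -max (N ω) 1 := by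
      have := h2.1
      simp only [Set.mem_ofPred_eq] at this
      rw [mul_neg, div_mul_cancel₀ _ hn.ne', hT]
      simp only
      linarith
    have h8 := (hV.1 h7).trans (hg _ _ hl)
    nlinarith
  filter_upwards [condLExp_mono (mΩ := ℋ) hle, hprob, hβpos,
    condLExp_mul_left hH hcm ((aemeasurable_const (b := (1 : ℝ≥0∞))).indicator₀ (hs.inter ht))]
    with ω h1 h2 hβp h3 h4
  refine le_trans ?_ h1
  rw [h3]
  have h5 : ω ∈ {ω | max (N ω) 1 ≤ T ω} := h4
  simp only [hc, Set.indicator_of_mem h5]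
  rw [mul_comm (β ω / 2), ENNReal.ofReal_mul' (by linarith)]
  gcongr
  exact h2.2

end Estimates

/-! ### Explicit thresholds from the comparison of powers. -/

section RealInequalities

variable {γ₁ γ₂ : ℝ}

/-- The higher power wins over the lower one beyond an explicit threshold. -/
theorem rpow_mul_sub_le (hγ₁ : 0 < γ₁) (hγ : γ₁ < γ₂) {L B c ρ : ℝ} (hL : 0 ≤ L) (hB : 0 ≤ B)
    (hc : 0 < c) (hρ : 1 ≤ ρ) (h : ((L + B) / c) ^ (1 / (γ₂ - γ₁)) ≤ ρ) :
    ρ ^ γ₁ * L - c * ρ ^ γ₂ ≤ -B := by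
  have hρ0 : 0 < ρ := by linarith
  have hδ : 0 < γ₂ - γ₁ := by linarith
  have h1 : (L + B) / c ≤ ρ ^ (γ₂ - γ₁) := by
    have h2 := Real.rpow_le_rpow (by positivity) h hδ.le
    rwa [← Real.rpow_mul (by positivity), one_div_mul_cancel hδ.ne', Real.rpow_one] at h2
  rw [div_le_iff₀ hc] at h1
  have h3 : ρ ^ γ₂ = ρ ^ γ₁ * ρ ^ (γ₂ - γ₁) := by
    rw [← Real.rpow_add hρ0]; congr 1; ring
  have h4 : 1 ≤ ρ ^ γ₁ := Real.one_le_rpow hρ hγ₁.le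
  rw [h3]
  nlinarith [mul_le_mul_of_nonneg_left h1 (zero_le_one.trans h4),
    mul_le_mul_of_nonneg_right h4 hB]

/-- The bound on the size of the relevant strategies. -/
noncomputable def strategyBound (γ₁ γ₂ M α β n L B : ℝ) : ℝ :=
  max 1 (max (2 * M / α) (max (2 * n / α)
    (((L + B) / (β / 2 * (α / (2 * n)) ^ γ₂)) ^ (1 / (γ₂ - γ₁)))))

/-- Each term of the maximum has its role: `ρ > 1` turns `max 1 ρ` into `ρ`; `αρ > 2M` gives `αρ - x
≥ αρ/2`; then `αρ > 2n` gives `n ≤ αρ - x`; the last term is the threshold of `rpow_mul_sub_le`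
after replacing `αρ - x` by `αρ/2`. -/
theorem utility_bound_of_strategyBound_lt (hγ₁ : 0 < γ₁) (hγ : γ₁ < γ₂)
    {M α β n L B ρ x : ℝ} (hα : 0 < α) (hβ : 0 < β) (hn : 1 ≤ n)
    (hL : 0 ≤ L) (hB : 0 ≤ B) (hx : x ≤ M) (h : strategyBound γ₁ γ₂ M α β n L B < ρ) :
    n ≤ α * ρ - x ∧
      max 1 ρ ^ γ₁ * L - β / 2 * ((α * ρ - x) / n) ^ γ₂ ≤ -B := by
  simp only [strategyBound, max_lt_iff] at h
  obtain ⟨h1, h2, h3, h4⟩ := h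
  have hn0 : 0 < n := by linarith
  rw [div_lt_iff₀ hα] at h2 h3
  have hT : α * ρ / 2 ≤ α * ρ - x := by nlinarith
  refine ⟨by nlinarith, ?_⟩
  rw [max_eq_right h1.le]
  have h5 : (α / (2 * n)) ^ γ₂ * ρ ^ γ₂ ≤ ((α * ρ - x) / n) ^ γ₂ := by
    rw [← Real.mul_rpow (by positivity) (by linarith)]
    refine Real.rpow_le_rpow (mul_nonneg (by positivity) (by linarith)) ?_ (by linarith)
    rw [le_div_iff₀ hn0]
    calc α / (2 * n) * ρ * n = α * ρ / 2 := by field_simp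
      _ ≤ _ := hT
  have h6 := rpow_mul_sub_le hγ₁ hγ hL hB (c := β / 2 * (α / (2 * n)) ^ γ₂) (by positivity)
    h1.le h4.le
  nlinarith

/-- A bound for the gain part of the utility in terms of the losses. -/
noncomputable def gainBound (γ₁ γ₂ α β n L : ℝ) : ℝ :=
  max 1 ((L / (β / 4 * (α / n) ^ γ₂)) ^ (1 / (γ₂ - γ₁))) ^ γ₁ * L

/-- A level of debt from which the value cannot exceed `-J`. -/
noncomputable def debtBound (γ₁ γ₂ α β n L J : ℝ) : ℝ :=
  n * max 1 ((4 * (J + gainBound γ₁ γ₂ α β n L) / β) ^ (1 / γ₂))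

theorem le_debtBound {α β n L J : ℝ} (hn : 1 ≤ n) : n ≤ debtBound γ₁ γ₂ α β n L J :=
  le_mul_of_one_le_right (by linarith) (le_max_left _ _)

/-- The factor `β/2` is split into two quarters. As `-x ≥ 0`, one quarter dominates `c ρ^γ₂` and
offsets the gains up to the constant `gainBound`, uniformly in `ρ`. The debt makes the other at
least `J` plus that constant. -/
theorem utility_bound_of_le_neg_debtBound (hγ₁ : 0 < γ₁) (hγ : γ₁ < γ₂)
    {α β n L J ρ x : ℝ} (hα : 0 < α) (hβ : 0 < β) (hn : 1 ≤ n)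
    (hL : 0 ≤ L) (hJ : 0 ≤ J) (hρ : 0 ≤ ρ) (hx : x ≤ -debtBound γ₁ γ₂ α β n L J) :
    n ≤ α * ρ - x ∧
      max 1 ρ ^ γ₁ * L - β / 2 * ((α * ρ - x) / n) ^ γ₂ ≤ -J := by
  have hn0 : 0 < n := by linarith
  have hγ₂ : 0 < γ₂ := by linarith
  have hαρ : 0 ≤ α * ρ := by positivity
  have hnN : n ≤ debtBound γ₁ γ₂ α β n L J := le_debtBound hn
  refine ⟨by linarith, ?_⟩
  set c := β / 4 * (α / n) ^ γ₂ with hc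
  have hc0 : 0 < c := by positivity
  set S := gainBound γ₁ γ₂ α β n L with hS
  have hLS : max 1 ρ ^ γ₁ * L - c * ρ ^ γ₂ ≤ S := by
    have hρ2 : 0 ≤ c * ρ ^ γ₂ := by positivity
    by_cases hle : max 1 ρ ≤ max 1 ((L / c) ^ (1 / (γ₂ - γ₁)))
    · have : max 1 ρ ^ γ₁ * L ≤ S :=
        mul_le_mul_of_nonneg_right (Real.rpow_le_rpow (by positivity) hle hγ₁.le) hL
      linarith
    · have hS0 : 0 ≤ S := by rw [hS, gainBound]; positivity
      rw [not_le, max_lt_iff, lt_max_iff, lt_max_iff] at hle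
      have h1 : 1 < ρ := by simpa using hle.1
      have h2 : (L / c) ^ (1 / (γ₂ - γ₁)) ≤ ρ := by
        have := max_lt_iff.2 ⟨lt_max_iff.2 hle.1, lt_max_iff.2 hle.2⟩
        rw [max_eq_right h1.le] at this
        exact (le_max_right _ _).trans this.le
      have h3 := rpow_mul_sub_le hγ₁ hγ hL le_rfl hc0 h1.le (by rwa [add_zero])
      rw [max_eq_right h1.le]
      linarith
  have hS0 : 0 ≤ S := by rw [hS, gainBound]; positivity
  have h1 : (α / n) ^ γ₂ * ρ ^ γ₂ ≤ ((α * ρ - x) / n) ^ γ₂ := by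
    rw [← Real.mul_rpow (by positivity) hρ]
    refine Real.rpow_le_rpow (by positivity) ?_ hγ₂.le
    rw [div_mul_eq_mul_div]
    gcongr
    linarith
  have h2 : 4 * (J + S) / β ≤ ((α * ρ - x) / n) ^ γ₂ := by
    have h3 : (4 * (J + S) / β) ^ (1 / γ₂) ≤ (α * ρ - x) / n := by
      rw [le_div_iff₀ hn0, mul_comm]
      refine le_trans (mul_le_mul_of_nonneg_left (le_max_right 1 _) hn0.le) ?_
      change debtBound γ₁ γ₂ α β n L J ≤ _
      linarith
    have h4 := Real.rpow_le_rpow (by positivity) h3 hγ₂.le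
    rwa [← Real.rpow_mul (by positivity), one_div_mul_cancel hγ₂.ne', Real.rpow_one] at h4
  rw [div_le_iff₀ hβ] at h2
  have h5 : c * ρ ^ γ₂ ≤ β / 4 * ((α * ρ - x) / n) ^ γ₂ := by
    rw [hc, mul_assoc]
    exact mul_le_mul_of_nonneg_left h1 (by positivity)
  linarith

end RealInequalities

/-! ### Reduction to strategies in `D` and to bounded strategies. -/

section Value

theorem neg_le_genCondExp_of_le {Ω : Type*} {ℋ m0 : MeasurableSpace Ω} {P : Measure Ω}
    {Z : Ω → ℝ} {ω : Ω} {b : ℝ} (hb : 0 ≤ b)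
    (h : condLExp ℋ P (fun ω => ENNReal.ofReal (-Z ω)) ω ≤ ENNReal.ofReal b) :
    ((-b : ℝ) : EReal) ≤ genCondExp ℋ P Z ω := by
  rw [genCondExp, ← zero_sub, EReal.coe_sub, EReal.coe_zero]
  refine EReal.sub_le_sub (EReal.coe_ennreal_nonneg _) ?_
  simpa [EReal.coe_ennreal_ofReal, hb] using EReal.coe_ennreal_le_coe_ennreal_iff.2 h

variable {Ω : Type*} {ℋ m0 : MeasurableSpace Ω} {P : Measure Ω} [IsProbabilityMeasure P]
  {d : ℕ} {Y : Ω → EuclideanSpace ℝ (Fin d)} {V : Ω → ℝ → ℝ} {X : Ω → ℝ}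

/-- To bound the value it is enough to consider strategies with values in the support subspace. -/
theorem value_le_of_forall (hH : ℋ ≤ m0) (hY : Measurable Y)
    {D : Ω → Set (EuclideanSpace ℝ (Fin d))} (hD : IsSupportSubspace ℋ P Y D)
    {g : Ω → EReal} (hg : Measurable g)
    (h : ∀ η : Ω → EuclideanSpace ℝ (Fin d), Measurable[ℋ] η → (∀ᵐ ω ∂P, η ω ∈ D ω) →
      condUtility ℋ P V Y X η ≤ᵐ[P] g) :
    value ℋ P V Y X ≤ᵐ[P] g := by
  refine (essSupFamily_spec P _).2.2 g hg ?_
  rintro _ ⟨ξ, hξ, rfl⟩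
  obtain ⟨η, hη, hηD, hηY⟩ := exists_projection hH hY hD hξ
  have heq : condUtility ℋ P V Y X η =ᵐ[P] condUtility ℋ P V Y X ξ :=
    genCondExp_congr_ae hH (hηY.mono fun ω hω => by simp only [hω])
  exact heq.symm.le.trans (h η hη hηD)

theorem condUtility_le_value {ξ : Ω → EuclideanSpace ℝ (Fin d)} (hξ : Measurable[ℋ] ξ) :
    condUtility ℋ P V Y X ξ ≤ᵐ[P] value ℋ P V Y X :=
  (essSupFamily_spec P _).2.1 _ ⟨ξ, hξ, rfl⟩

theorem condUtility_le_valueBounded {K : Ω → ℝ} {ξ : Ω → EuclideanSpace ℝ (Fin d)}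
    (hξ : Measurable[ℋ] ξ) (hK : ∀ᵐ ω ∂P, ‖ξ ω‖ ≤ K ω) :
    condUtility ℋ P V Y X ξ ≤ᵐ[P] valueBounded ℋ P V Y K X :=
  (essSupFamily_spec P _).2.1 _ ⟨ξ, hξ, hK, rfl⟩

theorem valueBounded_le_value {K : Ω → ℝ} :
    valueBounded ℋ P V Y K X ≤ᵐ[P] value ℋ P V Y X := by
  refine (essSupFamily_spec P _).2.2 _ (essSupFamily_spec P _).1 ?_
  rintro _ ⟨ξ, hξ, -, rfl⟩
  exact condUtility_le_value hξ

/-- If strategies exceeding `K` are no better than a strategy that does not invest at all, then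
the value is attained by strategies bounded by `K`. -/
theorem value_le_valueBounded (hH : ℋ ≤ m0) (hY : Measurable Y)
    {D : Ω → Set (EuclideanSpace ℝ (Fin d))} (hD : IsSupportSubspace ℋ P Y D)
    {K : Ω → ℝ} (hK : Measurable[ℋ] K) (hK0 : ∀ ω, 0 ≤ K ω)
    (h : ∀ η : Ω → EuclideanSpace ℝ (Fin d), Measurable[ℋ] η → (∀ᵐ ω ∂P, η ω ∈ D ω) →
      ∀ᵐ ω ∂P, K ω < ‖η ω‖ → condUtility ℋ P V Y X η ω ≤ condUtility ℋ P V Y X 0 ω) :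
    value ℋ P V Y X ≤ᵐ[P] valueBounded ℋ P V Y K X := by
  refine value_le_of_forall hH hY hD (essSupFamily_spec P _).1 fun η hη hηD => ?_
  -- Keep `η` where it is bounded by `K` and invest nothing elsewhere; as `s` is in `ℋ`, locality
  -- evaluates the utility piecewise.
  set s : Set Ω := {ω | ‖η ω‖ ≤ K ω} with hs_def
  have hs : MeasurableSet[ℋ] s := measurableSet_le (measurable_norm.comp hη) hK
  have hη' : Measurable[ℋ] (s.indicator η) := hη.indicator hs
  have hbd : ∀ᵐ ω ∂P, ‖s.indicator η ω‖ ≤ K ω := Filter.Eventually.of_forall fun ω => by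
    by_cases hω : ω ∈ s
    · rw [Set.indicator_of_mem hω]; exact hω
    · rw [Set.indicator_of_notMem hω, norm_zero]; exact hK0 ω
  have h1 : ∀ᵐ ω ∂P, ω ∈ s →
      condUtility ℋ P V Y X η ω = condUtility ℋ P V Y X (s.indicator η) ω :=
    genCondExp_congr_on hH hs (Filter.Eventually.of_forall fun ω hω => by
      rw [Set.indicator_of_mem hω])
  have h2 : ∀ᵐ ω ∂P, ω ∈ sᶜ →
      condUtility ℋ P V Y X 0 ω = condUtility ℋ P V Y X (s.indicator η) ω :=
    genCondExp_congr_on hH hs.compl (Filter.Eventually.of_forall fun ω hω => by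
      rw [Set.indicator_of_notMem hω]; rfl)
  filter_upwards [h η hη hηD, h1, h2, condUtility_le_valueBounded (V := V) (Y := Y) (X := X) hη' hbd]
    with ω h h1 h2 h3
  refine le_trans ?_ h3
  by_cases hω : ω ∈ s
  · exact (h1 hω).le
  · exact (h (not_le.1 hω)).trans (h2 hω).le

end Value

end OneStep

/-! ### The one-step lemma. -/

theorem lemma3p1 {Ω : Type*}
    -- the σ-algebras `ℋ ⊆ ℱ ⊆ m0`, containing the `P`-null sets
    (ℋ ℱ : MeasurableSpace Ω) [m0 : MeasurableSpace Ω] (P : Measure Ω) [IsProbabilityMeasure P]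
    (hHF : ℋ ≤ ℱ) (hF : ℱ ≤ m0)
    (hnull : ∀ s : Set Ω, MeasurableSet[m0] s → P s = 0 → MeasurableSet[ℋ] s)
    {d : ℕ} (Y : Ω → EuclideanSpace ℝ (Fin d)) (hY : Measurable[ℱ] Y)
    (D : Ω → Set (EuclideanSpace ℝ (Fin d))) (hD : OneStep.IsSupportSubspace ℋ P Y D)
    -- quantitative absence of arbitrage
    (α β : Ω → ℝ) (hα : Measurable[ℋ] α) (hβ : Measurable[ℋ] β)
    (hαpos : ∀ᵐ ω ∂P, 0 < α ω) (hβpos : ∀ᵐ ω ∂P, 0 < β ω)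
    (hNA : ∀ ξ : Ω → EuclideanSpace ℝ (Fin d), Measurable[ℋ] ξ → (∀ᵐ ω ∂P, ξ ω ∈ D ω) →
      ∀ᵐ ω ∂P, β ω ≤
        (P[{ω' | inner ℝ (ξ ω') (Y ω') ≤ -α ω' * ‖ξ ω'‖}.indicator (fun _ => (1 : ℝ)) | ℋ]) ω)
    -- the random function `V`
    (V : Ω → ℝ → ℝ) (hV : ∀ᵐ ω ∂P, Monotone (V ω) ∧ Continuous (V ω))
    (hVmeas : ∀ x : ℝ, Measurable[ℱ] (fun ω => V ω x))
    -- conditional integrability of `V⁻(x - |y||Y|)` and `V⁺(x + |y||Y|)`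
    (hVneg : ∀ x y : ℝ, ∀ᵐ ω ∂P,
      condLExp ℋ P (fun ω' => ENNReal.ofReal (-V ω' (x - |y| * ‖Y ω'‖))) ω < ⊤)
    (hVpos : ∀ x y : ℝ, ∀ᵐ ω ∂P,
      condLExp ℋ P (fun ω' => ENNReal.ofReal (V ω' (x + |y| * ‖Y ω'‖))) ω < ⊤)
    -- growth conditions; `γ₁` and `γ₂` are the upper and the lower exponent
    (C γ₁ γ₂ : ℝ) (hC : 0 < C) (hγ₁ : 0 < γ₁) (hγ : γ₁ < γ₂)
    (hgrowth : ∀ᵐ ω ∂P, ∀ x l : ℝ, 1 ≤ l →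
      V ω (l * x) ≤ l ^ γ₁ * V ω x + C * l ^ γ₁ ∧
      V ω (l * x) ≤ l ^ γ₂ * V ω x + C * l ^ γ₂)
    (N : Ω → ℝ) (hN : Measurable[ℋ] N) (hNnonneg : ∀ᵐ ω ∂P, 0 ≤ N ω)
    (hVN : ∀ᵐ ω ∂P, 1 - β ω / 2 ≤
      (P[{ω' | V ω' (-N ω') < -(2 * C / β ω') - 1}.indicator (fun _ => (1 : ℝ)) | ℋ]) ω) :
    -- strategies may be taken bounded by a variable `K` that works on all of `[x₀, x₁]`
    (∀ x₀ x₁ : ℝ, x₀ < x₁ → ∃ K : Ω → ℝ, Measurable[ℋ] K ∧ (∀ ω, 0 < K ω) ∧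
      ∀ x ∈ Set.Icc x₀ x₁,
        OneStep.value ℋ P V Y (fun _ => x) =ᵐ[P] OneStep.valueBounded ℋ P V Y K (fun _ => x)) ∧
    -- `v` is finite
    (∀ x : ℝ, ∀ᵐ ω ∂P, ⊥ < OneStep.value ℋ P V Y (fun _ => x) ω ∧
      OneStep.value ℋ P V Y (fun _ => x) ω < ⊤) ∧
    -- `v(-N') ≤ -I`, for the value at the random capital `-N'`, and also for the evaluation at
    -- `-N'` of any version `w` of the random field `v` with nondecreasing paths
    (∀ I : Ω → ℝ, Measurable[ℋ] I → (∀ᵐ ω ∂P, 0 < I ω) →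
      ∃ N' : Ω → ℝ, Measurable[ℋ] N' ∧ (∀ ω, 0 < N' ω) ∧
        (∀ᵐ ω ∂P, OneStep.value ℋ P V Y (fun ω' => -N' ω') ω ≤ ((-I ω : ℝ) : EReal)) ∧
        ∀ w : Ω → ℝ → EReal,
          (∀ x : ℝ, (fun ω => w ω x) =ᵐ[P] OneStep.value ℋ P V Y (fun _ => x)) →
          (∀ᵐ ω ∂P, Monotone (w ω)) →
          ∀ᵐ ω ∂P, w ω (-N' ω) ≤ ((-I ω : ℝ) : EReal)) := by
  have hH : ℋ ≤ m0 := hHF.trans hF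
  have hY' : Measurable Y := hY.mono hF le_rfl
  have hVm : ∀ x, Measurable fun ω => V ω x := fun x => (hVmeas x).mono hF le_rfl
  set n : Ω → ℝ := fun ω => max (N ω) 1 with hn
  have hnm : Measurable[ℋ] n := hN.max measurable_const
  have hn1 : ∀ ω, 1 ≤ n ω := fun ω => le_max_right _ _
  let L : ℝ → Ω → ℝ := fun M ω =>
    (condLExp ℋ P (fun ω => ENNReal.ofReal (V ω (M + ‖Y ω‖))) ω).toReal + C
  have hLm : ∀ M, Measurable[ℋ] (L M) := fun M =>
    (measurable_condLExp ℋ P _).ennreal_toReal.add_const C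
  have hL0 : ∀ M ω, 0 ≤ L M ω := fun M ω => add_nonneg ENNReal.toReal_nonneg hC.le
  have hpos : ∀ M : ℝ, 0 ≤ M → ∀ X : Ω → ℝ, (∀ᵐ ω ∂P, X ω ≤ M) →
      ∀ ξ : Ω → EuclideanSpace ℝ (Fin d), Measurable[ℋ] ξ → ∀ᵐ ω ∂P,
        condLExp ℋ P (fun ω => ENNReal.ofReal (V ω (X ω + inner ℝ (ξ ω) (Y ω)))) ω ≤
          ENNReal.ofReal (max 1 ‖ξ ω‖ ^ γ₁ * L M ω) := by
    intro M hM X hX ξ hξ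
    exact OneStep.condLExp_utility_pos_le hH hY' hV hVm hC
      (hgrowth.mono fun ω h x l hl => (h x l hl).1) hM
      (by simpa using hVpos M 1) hX hξ
  have hmain : ∀ M : ℝ, 0 ≤ M → ∀ X : Ω → ℝ, Measurable[ℋ] X → (∀ᵐ ω ∂P, X ω ≤ M) →
      ∀ ξ : Ω → EuclideanSpace ℝ (Fin d), Measurable[ℋ] ξ → (∀ᵐ ω ∂P, ξ ω ∈ D ω) → ∀ᵐ ω ∂P,
        n ω ≤ α ω * ‖ξ ω‖ - X ω → OneStep.condUtility ℋ P V Y X ξ ω ≤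
          ((max 1 ‖ξ ω‖ ^ γ₁ * L M ω
            - β ω / 2 * ((α ω * ‖ξ ω‖ - X ω) / n ω) ^ γ₂ : ℝ) : EReal) := by
    intro M hM X hXm hX ξ hξ hξD
    filter_upwards [hpos M hM X hX ξ hξ, OneStep.le_condLExp_utility_neg hH hY' hV hVm hC
      (hgrowth.mono fun ω h x l hl => (h x l hl).2) hα hβpos hN hVN hβ hXm hξ (hNA ξ hξ hξD),
      hβpos] with ω h1 h2 hb h3
    have hT : 0 ≤ α ω * ‖ξ ω‖ - X ω := by linarith [hn1 ω]
    have hn0 : 0 ≤ n ω := by linarith [hn1 ω]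
    exact OneStep.genCondExp_le_of_le (mul_nonneg (by positivity) (hL0 M ω))
      (by positivity) h1 (h2 h3)
  -- By monotonicity `-B M` bounds the utility of `ξ = 0` from below for every capital above `-M`,
  -- which makes `K` uniform on the interval.
  let B : ℝ → Ω → ℝ := fun M ω =>
    (condLExp ℋ P (fun ω => ENNReal.ofReal (-V ω (-M))) ω).toReal
  have hBm : ∀ M, Measurable[ℋ] (B M) := fun M => (measurable_condLExp ℋ P _).ennreal_toReal
  have hB0 : ∀ M ω, 0 ≤ B M ω := fun M ω => ENNReal.toReal_nonneg
  have hzero : ∀ M x : ℝ, -M ≤ x → ∀ᵐ ω ∂P,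
      ((-B M ω : ℝ) : EReal) ≤ OneStep.condUtility ℋ P V Y (fun _ => x) 0 ω := by
    intro M x hx
    have hle : (fun ω => ENNReal.ofReal
        (-V ω (x + inner ℝ ((0 : Ω → EuclideanSpace ℝ (Fin d)) ω) (Y ω)))) ≤ᵐ[P]
        fun ω => ENNReal.ofReal (-V ω (-M)) := by
      filter_upwards [hV] with ω hω
      refine ENNReal.ofReal_le_ofReal (neg_le_neg (hω.1 ?_))
      simpa using hx
    filter_upwards [condLExp_mono (mΩ := ℋ) hle, hVneg (-M) 0] with ω h1 h2
    refine OneStep.neg_le_genCondExp_of_le (hB0 M ω) (h1.trans ?_)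
    simp only [abs_zero, zero_mul, sub_zero] at h2
    rw [ENNReal.ofReal_toReal h2.ne]
  have hbounded : ∀ x₀ x₁ : ℝ, x₀ < x₁ → ∃ K : Ω → ℝ, Measurable[ℋ] K ∧ (∀ ω, 0 < K ω) ∧
      ∀ x ∈ Set.Icc x₀ x₁,
        OneStep.value ℋ P V Y (fun _ => x) =ᵐ[P]
          OneStep.valueBounded ℋ P V Y K (fun _ => x) := by
    intro x₀ x₁ _
    set M : ℝ := max |x₀| |x₁| with hM
    have hM0 : 0 ≤ M := (abs_nonneg x₀).trans (le_max_left _ _)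
    set K : Ω → ℝ := fun ω =>
      OneStep.strategyBound γ₁ γ₂ M (α ω) (β ω) (n ω) (L M ω) (B M ω) with hK
    have hKm : Measurable[ℋ] K := by
      have hLM := hLm M
      have hBM := hBm M
      rw [hK]
      simp only [OneStep.strategyBound]
      exact measurable_const.max ((measurable_const.div hα).max
        (((measurable_const.mul hnm).div hα).max
        (((hLM.add hBM).div ((hβ.div_const 2).mul
          ((hα.div (measurable_const.mul hnm)).pow_const γ₂))).pow_const _)))
    have hK0 : ∀ ω, 0 < K ω := fun ω => lt_of_lt_of_le one_pos (le_max_left _ _)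
    refine ⟨K, hKm, hK0, fun x hx => ?_⟩
    have hxM : |x| ≤ M := abs_le_max_abs_abs hx.1 hx.2
    refine Filter.EventuallyLE.antisymm ?_ OneStep.valueBounded_le_value
    refine OneStep.value_le_valueBounded hH hY' hD hKm (fun ω => (hK0 ω).le) fun η hη hηD => ?_
    filter_upwards [hmain M hM0 (fun _ => x) measurable_const
      (Filter.Eventually.of_forall fun _ => (abs_le.1 hxM).2) η hη hηD,
      hzero M x (abs_le.1 hxM).1, hαpos, hβpos] with ω h1 h2 ha hb h3
    obtain ⟨h4, h5⟩ := OneStep.utility_bound_of_strategyBound_lt hγ₁ hγ ha hb (hn1 ω) (hL0 M ω)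
      (hB0 M ω) (abs_le.1 hxM).2 h3
    exact (h1 h4).trans ((EReal.coe_le_coe_iff.2 h5).trans h2)
  refine ⟨hbounded, fun x => ?_, fun I hI hIpos => ?_⟩
  · obtain ⟨K, hKm, -, hK⟩ := hbounded x (x + 1) (by linarith)
    have hfin : OneStep.valueBounded ℋ P V Y K (fun _ => x) ≤ᵐ[P]
        fun ω => ((max 1 (K ω) ^ γ₁ * L |x| ω : ℝ) : EReal) := by
      refine (OneStep.essSupFamily_spec P _).2.2 _ ?_ ?_
      · exact ((((measurable_const.max hKm).pow_const γ₁).mul (hLm |x|)).mono hH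
          le_rfl).coe_real_ereal
      · rintro _ ⟨ξ, hξ, hξK, rfl⟩
        filter_upwards [hpos |x| (abs_nonneg x) (fun _ => x)
          (Filter.Eventually.of_forall fun _ => le_abs_self x) ξ hξ, hξK] with ω h1 h2
        have h3 : max 1 ‖ξ ω‖ ^ γ₁ * L |x| ω ≤ max 1 (K ω) ^ γ₁ * L |x| ω :=
          mul_le_mul_of_nonneg_right
            (Real.rpow_le_rpow (by positivity) (max_le_max_left 1 h2) hγ₁.le) (hL0 _ _)
        have h4 := OneStep.genCondExp_le_of_le (b := 0)
          (mul_nonneg (by positivity) (hL0 |x| ω)) le_rfl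
          (h1.trans (ENNReal.ofReal_le_ofReal h3)) (by simp)
        rwa [sub_zero] at h4
    filter_upwards [hK x ⟨le_rfl, by linarith⟩, hfin, hzero |x| x (neg_abs_le x),
      OneStep.condUtility_le_value (P := P) (V := V) (Y := Y) (X := fun _ => x)
        (@measurable_const _ _ _ ℋ (0 : EuclideanSpace ℝ (Fin d)))] with ω h1 h2 h3 h4
    refine ⟨(EReal.bot_lt_coe _).trans_le (h3.trans h4), ?_⟩
    rw [h1]
    exact h2.trans_lt (EReal.coe_lt_top _)
  -- `max (I ω) 0` is nonnegative everywhere, as `I` is positive only almost surely.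
  · set N₀ : Ω → ℝ := fun ω =>
      OneStep.debtBound γ₁ γ₂ (α ω) (β ω) (n ω) (L 1 ω) (max (I ω) 0) with hN₀
    have hN₀m : Measurable[ℋ] N₀ := by
      have hLM := hLm 1
      rw [hN₀]
      simp only [OneStep.debtBound, OneStep.gainBound]
      exact hnm.mul (measurable_const.max
        (((measurable_const.mul ((hI.max measurable_const).add
          (((measurable_const.max ((hLM.div ((hβ.div_const 4).mul
            ((hα.div hnm).pow_const γ₂))).pow_const _)).pow_const γ₁).mul hLM))).div hβ).pow_const
          _))
    have hN₀1 : ∀ ω, 1 ≤ N₀ ω := fun ω => (hn1 ω).trans (OneStep.le_debtBound (hn1 ω))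
    -- Localizing to `X ≤ -N₀` allows deterministic `X`, which the statement about `w` needs.
    have hdebt : ∀ X : Ω → ℝ, Measurable[ℋ] X → (∀ ω, X ω ≤ 1) → ∀ᵐ ω ∂P,
        X ω ≤ -N₀ ω → OneStep.value ℋ P V Y X ω ≤ ((-I ω : ℝ) : EReal) := by
      intro X hX hX1
      have hs : MeasurableSet {ω | X ω ≤ -N₀ ω} := hH _ (measurableSet_le hX hN₀m.neg)
      classical
      have h := OneStep.value_le_of_forall (V := V) (X := X) hH hY' hD
        (g := fun ω => if X ω ≤ -N₀ ω then ((-I ω : ℝ) : EReal) else ⊤)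
        (Measurable.ite hs ((hI.neg.mono hH le_rfl).coe_real_ereal) measurable_const)
        (fun η hη hηD => by
          filter_upwards [hmain 1 zero_le_one X hX (Filter.Eventually.of_forall hX1) η hη hηD,
            hαpos, hβpos] with ω h1 ha hb
          split_ifs with h2
          · obtain ⟨h4, h5⟩ := OneStep.utility_bound_of_le_neg_debtBound hγ₁ hγ ha hb (hn1 ω)
              (hL0 1 ω) (le_max_right (I ω) 0) (norm_nonneg (η ω)) h2
            refine (h1 h4).trans (EReal.coe_le_coe_iff.2 (h5.trans ?_))
            exact neg_le_neg (le_max_left _ _)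
          · exact le_top)
      filter_upwards [h] with ω h h2
      simpa [h2] using h
    -- The identity for `w` holds almost surely only for fixed `x`, hence jointly for integers. The
    -- extra `1` leaves room for `k = ⌈N₀⌉` with `-N' ≤ -k ≤ -N₀`, and monotonicity of `w`
    -- concludes.
    refine ⟨fun ω => N₀ ω + 1, hN₀m.add_const 1, fun ω => by linarith [hN₀1 ω], ?_,
      fun w hw hwmono => ?_⟩
    · filter_upwards [hdebt (fun ω => -(N₀ ω + 1)) (hN₀m.add_const 1).neg
        fun ω => by linarith [hN₀1 ω]] with ω h
      exact h (by linarith)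
    · have hint : ∀ᵐ ω ∂P, ∀ k : ℕ, -(k : ℝ) ≤ -N₀ ω →
          w ω (-(k : ℝ)) ≤ ((-I ω : ℝ) : EReal) := by
        refine ae_all_iff.2 fun k => ?_
        filter_upwards [hdebt (fun _ => -(k : ℝ)) measurable_const
          fun _ => by linarith [k.cast_nonneg (α := ℝ)], hw (-(k : ℝ))] with ω h1 h2 h3
        rw [h2]
        exact h1 h3
      filter_upwards [hint, hwmono] with ω h1 h2
      have h3 := Nat.le_ceil (N₀ ω)
      have h4 := Nat.ceil_lt_add_one (zero_le_one.trans (hN₀1 ω))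
      exact (h2 (by linarith)).trans (h1 ⌈N₀ ω⌉₊ (by linarith))
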